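/- For non-negative integers $m,K,r,s$ let $C_m^{(K)}(r\to s)$ denote the number of lattice paths from $(0,r)$ to $(m,s)$ consisting of up-steps $(1,1)$ and down-steps $(1,-1)$ that never pass below the $x$-axis and never pass above the horizontal line $y=K$. Let $n,k,r,s$ be non-negative integers with $0\le r,s\le 2k-1$. Then $$ \det\left(C^{(2k-1)}_{2n+2i+2j+r+s}(r\to s)\right)_{0\le i,j\le k-1} =\begin{cases} 0, & \text{if }\gcd(r+1,2k+1)\ne 1\text{ or }\gcd(s+1,2k+1)\ne 1,\\[4pt] (-1)^{\sum_{i=1}^{k}\left(\left\lfloor \frac{i(r+1)}{2k+1}\right\rfloor+\left\lfloor \frac{i(s+1)}{2k+1}\right\rfloor\right)}, & \text{if }\gcd(r+1,2k+1)=\gcd(s+1,2k+1)=1. \end{cases} $$ In particular, the determinant does not depend on $n$. -/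

import Mathlib

/-- `IsBoundedUpDownPath k n r s p` says that the heights `p 0, p 1, …, p n` are those of an
up-down path (steps `(1, 1)` and `(1, -1)`) from `(0, r)` to `(n, s)`. The path stays between
the `x`-axis and the line `y = k` because its heights lie in `Fin (k + 1) = {0, …, k}`. -/
def IsBoundedUpDownPath (k n r s : ℕ) (p : Fin (n + 1) → Fin (k + 1)) : Prop :=
  (p 0 : ℕ) = r ∧ (p (Fin.last n) : ℕ) = s ∧
    ∀ i : Fin n, (p i.succ : ℤ) - (p i.castSucc : ℤ) = 1 ∨
      (p i.succ : ℤ) - (p i.castSucc : ℤ) = -1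

instance (k n r s : ℕ) : DecidablePred (IsBoundedUpDownPath k n r s) := fun p => by
  unfold IsBoundedUpDownPath
  infer_instance

/-- The number `C_n^{(k)}(r → s)` of up-down paths from `(0, r)` to `(n, s)` that do not pass
below the `x`-axis and do not pass above the line `y = k`. -/
def numBoundedUpDownPaths (k n r s : ℕ) : ℕ :=
  (Finset.univ.filter (IsBoundedUpDownPath k n r s)).card

open Finset Matrix

/-! Path counts are entries of powers of the adjacency matrix. Cutting each path after `2i + r`
steps, where parity forces an even height, factors the Hankel matrix into two k × k matrices
(`hankel_eq_mul_transpose`), one for each of `r` and `s`. With θ_j = jπ/(2k+1), the vectors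
sin((x+1)θ_j) are eigenvectors for 2cos θ_j. Multiplying a factor by their values at even heights
gives a column-scaled Vandermonde matrix in (2cos θ_j)², and the matrix of those values has the same
Vandermonde determinant times ∏ sin θ_j (`det_sin_odd`). After cancellation, and since ∏ 2cos θ_j =
1, a factor has determinant ∏ sin((a+1)θ_j) / ∏ sin θ_j. This is a sign or zero, by an argument in
the style of Gauss's lemma. -/

/-- The adjacency matrix of the path with vertices `0, …, K`. -/
def pathAdj (R : Type*) [Semiring R] (K : ℕ) : Matrix (Fin (K + 1)) (Fin (K + 1)) R :=
  Matrix.of fun a b => if (b : ℕ) = a + 1 ∨ (a : ℕ) = b + 1 then 1 else 0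

/-! ### Path counts as matrix powers -/

theorem card_chains_eq_pow {α : Type*} [Fintype α] [DecidableEq α] (r : α → α → Prop)
    [DecidableRel r] (m : ℕ) (a b : α) :
    #{p : Fin (m + 1) → α | p 0 = a ∧ p (Fin.last m) = b ∧ ∀ i : Fin m, r (p i.castSucc) (p i.succ)}
      = ((Matrix.of fun x y => if r x y then (1 : ℕ) else 0) ^ m) a b := by
  induction m generalizing a with
  | zero =>
    simp only [pow_zero, Matrix.one_apply]
    rw [Finset.card_filter, ← (Equiv.funUnique (Fin 1) α).symm.sum_comp]
    simp [Fin.last, ite_and]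
  | succ m ih =>
    rw [pow_succ', Matrix.mul_apply]
    simp only [← ih]
    rw [Finset.card_filter, ← (Fin.consEquiv fun _ : Fin (m + 2) => α).sum_comp,
      Fintype.sum_prod_type, Finset.sum_eq_single a]
    · simp only [Finset.card_filter, Finset.mul_sum]
      rw [Finset.sum_comm]
      refine Finset.sum_congr rfl fun q _ => ?_
      rw [Finset.sum_eq_single (q 0)]
      · simp only [Fin.consEquiv, Equiv.coe_fn_mk, Fin.cons_zero, true_and, Fin.forall_fin_succ,
          ← Fin.succ_last, Fin.cons_succ, Fin.castSucc_zero, Matrix.of_apply,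
          ← Fin.succ_castSucc]
        by_cases h : r a (q 0) <;> simp [h]
      · intro x _ hx
        simp [hx.symm]
      · simp
    · intro x _ hx
      refine Finset.sum_eq_zero fun q _ => ?_
      simp [Fin.consEquiv, hx]
    · simp

theorem numBoundedUpDownPaths_eq_pow (K m : ℕ) (a b : Fin (K + 1)) :
    numBoundedUpDownPaths K m a b = (pathAdj ℕ K ^ m) a b := by
  unfold pathAdj
  rw [← card_chains_eq_pow (fun x y : Fin (K + 1) => (y : ℕ) = x + 1 ∨ (x : ℕ) = y + 1)]
  unfold numBoundedUpDownPaths IsBoundedUpDownPath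
  congr 1
  ext p
  simp only [Finset.mem_filter, Finset.mem_univ, true_and, ← Fin.ext_iff]
  refine and_congr_right fun _ => and_congr_right fun _ => forall_congr' fun i => ?_
  omega

theorem pathAdj_pow_map (R : Type*) [Semiring R] (K m : ℕ) (a b : Fin (K + 1)) :
    (((pathAdj ℕ K ^ m) a b : ℕ) : R) = (pathAdj R K ^ m) a b := by
  have h : (pathAdj ℕ K).map (Nat.castRingHom R) = pathAdj R K := by
    ext x y
    simp only [pathAdj, Matrix.map_apply, Matrix.of_apply]
    split_ifs <;> simp
  rw [← h, ← Matrix.map_pow]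
  simp

theorem pathAdj_pow_symm {R : Type*} [CommSemiring R] (K m : ℕ) (a b : Fin (K + 1)) :
    (pathAdj R K ^ m) a b = (pathAdj R K ^ m) b a := by
  have h : (pathAdj R K)ᵀ = pathAdj R K := by
    ext x y
    simp [pathAdj, or_comm]
  rw [← Matrix.transpose_apply (pathAdj R K ^ m), Matrix.transpose_pow, h]

theorem pathAdj_pow_eq_zero {R : Type*} [Semiring R] (K m : ℕ) (a b : Fin (K + 1))
    (h : ((a : ℕ) + b + m) % 2 = 1) : (pathAdj R K ^ m) a b = 0 := by
  induction m generalizing a with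
  | zero =>
    rw [pow_zero, Matrix.one_apply_ne]
    rintro rfl
    omega
  | succ m ih =>
    rw [pow_succ', Matrix.mul_apply]
    refine Finset.sum_eq_zero fun x _ => ?_
    by_cases hx : (x : ℕ) = a + 1 ∨ (a : ℕ) = x + 1
    · rw [ih x (by omega), mul_zero]
    · simp [pathAdj, hx]

/-! ### Sine eigenvectors and their determinant -/

theorem pathAdj_mulVec_sin (K : ℕ) (θ : ℝ) (hθ : Real.sin ((K + 2 : ℕ) * θ) = 0) :
    pathAdj ℝ K *ᵥ (fun x => Real.sin (((x : ℕ) + 1 : ℝ) * θ)) =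
      (2 * Real.cos θ) • fun x : Fin (K + 1) => Real.sin (((x : ℕ) + 1 : ℝ) * θ) := by
  ext a
  set f : ℕ → ℝ := fun y => Real.sin ((y : ℝ) * θ) with hf
  have hup : ∑ x : Fin (K + 1), (if (x : ℕ) = a + 1 then f (x + 1) else 0) = f (a + 2) := by
    rw [Fin.sum_univ_eq_sum_range (fun x => if x = (a : ℕ) + 1 then f (x + 1) else 0),
      Finset.sum_ite_eq']
    split_ifs with h
    · rfl
    -- At the top vertex the missing neighbour would contribute sin((K+2)θ), which `hθ` makes zero.
    · have : (a : ℕ) = K := by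
        have := a.2
        simp at h
        omega
      rw [this]
      exact hθ.symm
  have hdown : ∑ x : Fin (K + 1), (if (a : ℕ) = x + 1 then f (x + 1) else 0) = f a := by
    rw [Fin.sum_univ_eq_sum_range (fun x => if (a : ℕ) = x + 1 then f (x + 1) else 0)]
    rcases Nat.eq_zero_or_pos (a : ℕ) with h | h
    · simp [h, hf]
    · rw [Finset.sum_eq_single ((a : ℕ) - 1)]
      · rw [if_pos (by omega), Nat.sub_add_cancel h]
      · intro x _ hx
        rw [if_neg (by omega)]
      · intro h'
        exact absurd (mem_range.2 (by omega)) h'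
  have hsum : (pathAdj ℝ K *ᵥ (fun x => Real.sin (((x : ℕ) + 1 : ℝ) * θ))) a
      = f (a + 2) + f a := by
    rw [← hup, ← hdown, ← Finset.sum_add_distrib, Matrix.mulVec, dotProduct]
    refine Finset.sum_congr rfl fun x _ => ?_
    simp only [pathAdj, Matrix.of_apply, hf]
    by_cases h1 : (x : ℕ) = a + 1
    · simp [h1, show ¬ (a : ℕ) = a + 1 + 1 by omega]
    · simp [h1]
  rw [hsum, Pi.smul_apply, smul_eq_mul]
  simp only [hf]
  push_cast
  have e1 : ((a : ℕ) + 2 : ℝ) * θ = ((a : ℕ) + 1 : ℝ) * θ + θ := by ring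
  have e2 : ((a : ℕ) : ℝ) * θ = ((a : ℕ) + 1 : ℝ) * θ - θ := by ring
  rw [e1, e2, Real.sin_add, Real.sin_sub]
  ring

theorem pathAdj_pow_mulVec_sin (K m : ℕ) (θ : ℝ) (hθ : Real.sin ((K + 2 : ℕ) * θ) = 0)
    (a : Fin (K + 1)) :
    ∑ x, (pathAdj ℝ K ^ m) a x * Real.sin (((x : ℕ) + 1 : ℝ) * θ) =
      (2 * Real.cos θ) ^ m * Real.sin (((a : ℕ) + 1 : ℝ) * θ) := by
  suffices h : (pathAdj ℝ K ^ m) *ᵥ (fun x => Real.sin (((x : ℕ) + 1 : ℝ) * θ)) =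
      (2 * Real.cos θ) ^ m • fun x : Fin (K + 1) => Real.sin (((x : ℕ) + 1 : ℝ) * θ) from
    congrFun h a
  induction m with
  | zero => simp
  | succ m ih =>
    rw [pow_succ, ← Matrix.mulVec_mulVec, pathAdj_mulVec_sin K θ hθ, Matrix.mulVec_smul, ih,
      smul_smul, pow_succ']

theorem sum_fin_two_mul {M : Type*} [AddCommMonoid M] (k : ℕ) (f : ℕ → M)
    (hf : ∀ x, x % 2 = 1 → f x = 0) : ∑ x ∈ range (2 * k), f x = ∑ l ∈ range k, f (2 * l) := by
  induction k with
  | zero => simp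
  | succ k ih =>
    rw [mul_add, mul_one, Finset.sum_range_succ, Finset.sum_range_succ, ih,
      Finset.sum_range_succ, hf (2 * k + 1) (by omega), add_zero]

-- Adding and subtracting 2θ gives Q_{l+2} = (X - 2) Q_{l+1} - Q_l. Monicity and exact degree reduce
-- the sine determinant to a Vandermonde one.
open Polynomial in
theorem exists_monic_sin_odd (l : ℕ) : ∃ Q : ℝ[X], Q.Monic ∧ Q.natDegree = l ∧
    ∀ θ : ℝ, Real.sin ((2 * l + 1 : ℝ) * θ) = Real.sin θ * Q.eval ((2 * Real.cos θ) ^ 2) := by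
  induction l using Nat.strong_induction_on with
  | _ l ih =>
    match l with
    | 0 => exact ⟨1, monic_one, natDegree_one, by simp⟩
    | 1 =>
      refine ⟨X - C 1, monic_X_sub_C 1, natDegree_X_sub_C 1, fun θ => ?_⟩
      have e : (2 * ((1 : ℕ) : ℝ) + 1) * θ = 3 * θ := by norm_num
      rw [e, Real.sin_three_mul]
      simp only [eval_sub, eval_X, eval_C, mul_pow, Real.cos_sq']
      ring
    | l + 2 =>
      obtain ⟨P, hPm, hPd, hP⟩ := ih l (by omega)
      obtain ⟨Q, hQm, hQd, hQ⟩ := ih (l + 1) (by omega)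
      have hm : ((X - C 2) * Q).Monic := (monic_X_sub_C 2).mul hQm
      have hd : ((X - C 2) * Q).natDegree = l + 2 := by
        rw [(monic_X_sub_C 2).natDegree_mul hQm, natDegree_X_sub_C, hQd]
        omega
      have hlt : P.natDegree < ((X - C 2) * Q).natDegree := by omega
      refine ⟨(X - C 2) * Q - P, hm.sub_of_left (degree_lt_degree hlt), ?_, fun θ => ?_⟩
      · rw [natDegree_sub_eq_left_of_natDegree_lt hlt, hd]
      · have h1 := hP θ
        have h2 := hQ θ
        push_cast at h2 ⊢
        have e1 : (2 * ((l : ℝ) + 2) + 1) * θ = (2 * ((l : ℝ) + 1) + 1) * θ + 2 * θ := by ring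
        have e2 : (2 * (l : ℝ) + 1) * θ = (2 * ((l : ℝ) + 1) + 1) * θ - 2 * θ := by ring
        rw [e2, Real.sin_sub] at h1
        rw [e1, Real.sin_add]
        simp only [eval_sub, eval_mul, eval_X, eval_C]
        rw [Real.cos_two_mul] at h1 ⊢
        linear_combination (4 * Real.cos θ ^ 2 - 2) * h2 - h1

theorem det_sin_odd {k : ℕ} (θ : Fin k → ℝ) :
    (Matrix.of fun j l : Fin k => Real.sin ((2 * (l : ℕ) + 1 : ℝ) * θ j)).det =
      (∏ j, Real.sin (θ j)) * (Matrix.vandermonde fun j => (2 * Real.cos (θ j)) ^ 2).det := by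
  choose Q hQm hQd hQ using exists_monic_sin_odd
  rw [Matrix.det_eval_matrixOfPolynomials_eq_det_vandermonde _ (fun l : Fin k => Q l)
    (fun l => hQd l) (fun l => hQm l), ← Matrix.det_mul_column]
  congr 1
  ext j l
  simp [hQ]

/-! ### Trigonometric products at multiples of π/(2k+1) -/

theorem sin_pi_mul_div_eq (N a : ℕ) (hN : 0 < N) :
    Real.sin (a * (Real.pi / N)) =
      (-1) ^ (a / N) * Real.sin ((a % N : ℕ) * (Real.pi / N)) := by
  have hN' : (N : ℝ) ≠ 0 := by positivity
  have e : (a : ℝ) * (Real.pi / N) =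
      (a % N : ℕ) * (Real.pi / N) + (a / N : ℕ) * Real.pi := by
    conv_lhs => rw [← Nat.mod_add_div a N]
    push_cast
    field_simp
  rw [e, Real.sin_add_nat_mul_pi]

/-- As in Gauss's lemma, folding jm mod N into 1, …, k by x ↦ N - x permutes that range. Since sin(π
- t) = sin t, folding costs no sign; signs come only from the quotients. -/
theorem prod_sin_mul_of_coprime (k m : ℕ) (hm : Nat.gcd m (2 * k + 1) = 1) :
    ∏ j ∈ Icc 1 k, Real.sin ((j * m : ℕ) * (Real.pi / (2 * k + 1 : ℕ))) =
      (-1) ^ (∑ j ∈ Icc 1 k, j * m / (2 * k + 1)) *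
        ∏ j ∈ Icc 1 k, Real.sin (j * (Real.pi / (2 * k + 1 : ℕ))) := by
  set N := 2 * k + 1 with hNdef
  have hN : 0 < N := by omega
  have hcop : Nat.Coprime N m := Nat.Coprime.symm hm
  set g : ℕ → ℕ := fun j => if j * m % N ≤ k then j * m % N else N - j * m % N with hg
  have hgsin : ∀ j, Real.sin ((j * m % N : ℕ) * (Real.pi / N)) =
      Real.sin (g j * (Real.pi / N)) := by
    intro j
    simp only [hg]
    split_ifs with h
    · rfl
    · have hlt := Nat.mod_lt (j * m) hN
      rw [Nat.cast_sub hlt.le, sub_mul, mul_div_cancel₀ _ (by positivity : (N : ℝ) ≠ 0),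
        Real.sin_pi_sub]
  have hmaps : ∀ j ∈ Icc 1 k, g j ∈ Icc 1 k := by
    intro j hj
    rw [mem_Icc] at hj
    have hlt := Nat.mod_lt (j * m) hN
    have hne : j * m % N ≠ 0 := fun h => by
      have := Nat.le_of_dvd (by omega) (hcop.dvd_of_dvd_mul_right (Nat.dvd_of_mod_eq_zero h))
      omega
    simp only [hg, mem_Icc]
    split_ifs <;> omega
  have hinj : Set.InjOn g (Icc 1 k : Finset ℕ) := by
    intro i hi j hj hij
    rw [mem_coe, mem_Icc] at hi hj
    have hli := Nat.mod_lt (i * m) hN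
    have hlj := Nat.mod_lt (j * m) hN
    have hcases : i * m % N = j * m % N ∨ i * m % N + j * m % N = N := by
      simp only [hg] at hij
      split_ifs at hij <;> omega
    rcases hcases with h | h
    · have h' : i ≡ j [MOD N] := Nat.ModEq.cancel_right_of_coprime hcop h
      have := Nat.ModEq.eq_of_lt_of_lt h' (by omega) (by omega)
      exact this
    · exfalso
      have hd : N ∣ (i + j) * m := by
        rw [add_mul]
        apply Nat.dvd_of_mod_eq_zero
        rw [Nat.add_mod, h, Nat.mod_self]
      have := Nat.le_of_dvd (by omega) (hcop.dvd_of_dvd_mul_right hd)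
      omega
  have hsurj : Set.SurjOn g (Icc 1 k : Finset ℕ) (Icc 1 k : Finset ℕ) :=
    Finset.surjOn_of_injOn_of_card_le g hmaps hinj le_rfl
  rw [Finset.prod_congr rfl fun j _ => sin_pi_mul_div_eq N (j * m) hN, Finset.prod_mul_distrib,
    Finset.prod_pow_eq_pow_sum]
  congr 1
  exact Finset.prod_nbij g hmaps hinj hsurj fun j _ => hgsin j

theorem prod_sin_mul_of_not_coprime (k m : ℕ) (hm : Nat.gcd m (2 * k + 1) ≠ 1) :
    ∏ j ∈ Icc 1 k, Real.sin ((j * m : ℕ) * (Real.pi / (2 * k + 1 : ℕ))) = 0 := by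
  obtain ⟨c, hc⟩ := Nat.gcd_dvd_right m (2 * k + 1)
  obtain ⟨e, he⟩ := Nat.gcd_dvd_left m (2 * k + 1)
  set d := Nat.gcd m (2 * k + 1)
  have hd0 : d ≠ 0 := by rintro h; simp [h] at hc
  have hd2 : d ≠ 2 := by rintro h; rw [h] at hc; omega
  have hd : 3 ≤ d := by omega
  have hc0 : 1 ≤ c := by
    rcases Nat.eq_zero_or_pos c with h | h
    · simp [h] at hc
    · exact h
  have hck : c ≤ k := by nlinarith
  -- The index c = (2k+1)/d is at most k because d is odd and not 1; cm is then a multiple of 2k+1.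
  refine Finset.prod_eq_zero (mem_Icc.2 ⟨hc0, hck⟩) ?_
  have h : c * m = e * (2 * k + 1) := by
    rw [hc, he]
    ring
  rw [h, Nat.cast_mul, mul_assoc, mul_div_cancel₀ _ (by positivity), Real.sin_nat_mul_pi]

theorem prod_sin_pos (k : ℕ) :
    0 < ∏ j ∈ Icc 1 k, Real.sin (j * (Real.pi / (2 * k + 1 : ℕ))) := by
  refine Finset.prod_pos fun j hj => ?_
  rw [mem_Icc] at hj
  have hj1 : (0 : ℝ) < j := by exact_mod_cast hj.1
  apply Real.sin_pos_of_pos_of_lt_pi (by positivity)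
  rw [← mul_div_assoc, div_lt_iff₀ (by positivity), mul_comm]
  have : (j : ℝ) < (2 * k + 1 : ℕ) := by exact_mod_cast (by omega : j < 2 * k + 1)
  exact mul_lt_mul_of_pos_left this Real.pi_pos

/-- This is the coprime case m = 2: every quotient vanishes, and the double-angle formula supplies
the cosines. -/
theorem prod_two_cos (k : ℕ) :
    ∏ j ∈ Icc 1 k, 2 * Real.cos (j * (Real.pi / (2 * k + 1 : ℕ))) = 1 := by
  have h := prod_sin_mul_of_coprime k 2 (by simp)
  rw [Finset.sum_eq_zero, pow_zero, one_mul] at h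
  · have h' : ∀ j ∈ Icc 1 k, Real.sin ((j * 2 : ℕ) * (Real.pi / (2 * k + 1 : ℕ))) =
        Real.sin (j * (Real.pi / (2 * k + 1 : ℕ))) *
          (2 * Real.cos (j * (Real.pi / (2 * k + 1 : ℕ)))) := by
      intro j _
      have e : ((j * 2 : ℕ) : ℝ) * (Real.pi / (2 * k + 1 : ℕ)) =
          2 * (j * (Real.pi / (2 * k + 1 : ℕ))) := by
        push_cast
        ring
      rw [e, Real.sin_two_mul]
      ring
    rw [Finset.prod_congr rfl h', Finset.prod_mul_distrib] at h
    exact mul_left_cancel₀ (prod_sin_pos k).ne' (h.trans (mul_one _).symm)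
  · intro j hj
    rw [mem_Icc] at hj
    exact Nat.div_eq_of_lt (by omega)

theorem prod_fin_succ_eq_prod_Icc {M : Type*} [CommMonoid M] (k : ℕ) (f : ℕ → M) :
    ∏ j : Fin k, f (j + 1) = ∏ j ∈ Icc 1 k, f j := by
  rw [Fin.prod_univ_eq_prod_range (fun j => f (j + 1)), Finset.range_eq_Ico,
    Finset.prod_Ico_add' f 0 k 1]
  rfl

/-- All angles lie in [0, π/2], where cosine is nonnegative and injective, so squaring merges no
nodes and the Vandermonde determinant can be cancelled. -/
theorem cos_sq_injective (k : ℕ) : Function.Injective fun j : Fin k =>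
    (2 * Real.cos (((j + 1 : ℕ) : ℝ) * (Real.pi / (2 * k + 1 : ℕ)))) ^ 2 := by
  have hmem : ∀ j : Fin k, ((j + 1 : ℕ) : ℝ) * (Real.pi / (2 * k + 1 : ℕ)) ∈
      Set.Icc 0 (Real.pi / 2) := by
    intro j
    refine ⟨by positivity, ?_⟩
    rw [← mul_div_assoc, div_le_div_iff₀ (by positivity) (by norm_num)]
    have : ((j + 1 : ℕ) : ℝ) * 2 ≤ (2 * k + 1 : ℕ) := by
      exact_mod_cast (by omega : ((j : ℕ) + 1) * 2 ≤ 2 * k + 1)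
    nlinarith [Real.pi_pos]
  have hcos : ∀ j : Fin k, 0 ≤ Real.cos (((j + 1 : ℕ) : ℝ) * (Real.pi / (2 * k + 1 : ℕ))) :=
    fun j => Real.cos_nonneg_of_mem_Icc ⟨by linarith [(hmem j).1, Real.pi_pos], (hmem j).2⟩
  intro i j hij
  have h := (pow_left_inj₀ (mul_nonneg zero_le_two (hcos i)) (mul_nonneg zero_le_two (hcos j))
    two_ne_zero).1 hij
  have h' := Real.injOn_cos ⟨(hmem i).1, by linarith [(hmem i).2, Real.pi_pos]⟩
    ⟨(hmem j).1, by linarith [(hmem j).2, Real.pi_pos]⟩ (mul_left_cancel₀ two_ne_zero h)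
  have hpi : Real.pi / (2 * k + 1 : ℕ) ≠ 0 := by positivity
  have h'' : (i : ℕ) + 1 = j + 1 := by exact_mod_cast mul_right_cancel₀ hpi h'
  exact Fin.ext (by omega)

/-! ### Factorisation of the Hankel matrix -/

/-- The walks from `a` of lengths `2 * n + 2 * i + a` that end at the even heights `2 * l`. -/
def evenWalkMatrix (k : ℕ) (hk : 0 < k) (n : ℕ) (a : Fin (2 * k - 1 + 1)) :
    Matrix (Fin k) (Fin k) ℝ :=
  Matrix.of fun i l => (pathAdj ℝ (2 * k - 1) ^ (2 * n + 2 * (i : ℕ) + a)) a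
    ⟨2 * l, by omega⟩

theorem sum_even_heights {M : Type*} [AddCommMonoid M] (k : ℕ) (hk : 0 < k)
    (f : Fin (2 * k - 1 + 1) → M) (hf : ∀ x : Fin (2 * k - 1 + 1), (x : ℕ) % 2 = 1 → f x = 0) :
    ∑ x, f x = ∑ l : Fin k, f ⟨2 * l, by omega⟩ := by
  set g : ℕ → M := fun x => if h : x < 2 * k - 1 + 1 then f ⟨x, h⟩ else 0 with hg
  have h1 : ∑ x, f x = ∑ x ∈ range (2 * k), g x := by
    rw [show range (2 * k) = range (2 * k - 1 + 1) by congr 1; omega, ← Fin.sum_univ_eq_sum_range]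
    exact Finset.sum_congr rfl fun x _ => by simp only [hg, dif_pos x.2]
  rw [h1, sum_fin_two_mul k g, ← Fin.sum_univ_eq_sum_range (fun l => g (2 * l))]
  · refine Finset.sum_congr rfl fun l _ => ?_
    simp only [hg]
    rw [dif_pos]
  · intro x hx
    simp only [hg]
    split_ifs with h
    · exact hf _ hx
    · rfl

theorem det_evenWalkMatrix (k : ℕ) (hk : 0 < k) (n : ℕ) (a : Fin (2 * k - 1 + 1)) :
    (evenWalkMatrix k hk n a).det *
        ∏ j ∈ Icc 1 k, Real.sin (j * (Real.pi / (2 * k + 1 : ℕ))) =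
      ∏ j ∈ Icc 1 k, Real.sin ((j * (a + 1) : ℕ) * (Real.pi / (2 * k + 1 : ℕ))) := by
  set θ : Fin k → ℝ := fun j => ((j + 1 : ℕ) : ℝ) * (Real.pi / (2 * k + 1 : ℕ)) with hθ
  set V := Matrix.vandermonde fun j => (2 * Real.cos (θ j)) ^ 2 with hV
  have hVdet : V.det ≠ 0 := Matrix.det_vandermonde_ne_zero_iff.2 (cos_sq_injective k)
  have hmul : evenWalkMatrix k hk n a *
      (Matrix.of fun j l : Fin k => Real.sin ((2 * (l : ℕ) + 1 : ℝ) * θ j))ᵀ =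
      Matrix.of fun i j => ((2 * Real.cos (θ j)) ^ (2 * n + (a : ℕ)) *
        Real.sin (((a : ℕ) + 1 : ℝ) * θ j)) * Vᵀ i j := by
    ext i j
    have hθj : Real.sin ((2 * k - 1 + 2 : ℕ) * θ j) = 0 := by
      rw [show 2 * k - 1 + 2 = 2 * k + 1 by omega, hθ]
      have e : ((2 * k + 1 : ℕ) : ℝ) * (((j + 1 : ℕ) : ℝ) * (Real.pi / (2 * k + 1 : ℕ))) =
          ((j + 1 : ℕ) : ℝ) * Real.pi := by
        have : ((2 * k + 1 : ℕ) : ℝ) ≠ 0 := by positivity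
        field_simp
      simp only [e, Real.sin_nat_mul_pi]
    have h := pathAdj_pow_mulVec_sin (2 * k - 1) (2 * n + 2 * (i : ℕ) + a) (θ j) hθj a
    rw [sum_even_heights k hk] at h
    · simp only [evenWalkMatrix, Matrix.mul_apply, Matrix.of_apply, Matrix.transpose_apply, hV,
        Matrix.vandermonde_apply]
      push_cast at h
      rw [h, ← pow_mul]
      ring
    · intro x hx
      rw [pathAdj_pow_eq_zero _ _ _ _ (by omega), zero_mul]
  have hdet := congrArg Matrix.det hmul
  rw [Matrix.det_mul, Matrix.det_transpose, det_sin_odd, Matrix.det_mul_row,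
    Matrix.det_transpose, ← hV, ← mul_assoc] at hdet
  have hdet' := mul_right_cancel₀ hVdet hdet
  rw [Finset.prod_mul_distrib, Finset.prod_pow] at hdet'
  have hc : ∏ j, 2 * Real.cos (θ j) = 1 := by
    rw [← prod_two_cos k]
    exact prod_fin_succ_eq_prod_Icc k
      fun j => 2 * Real.cos ((j : ℝ) * (Real.pi / (2 * k + 1 : ℕ)))
  -- The dependence on `n` disappears here.
  rw [hc, one_pow, one_mul] at hdet'
  rw [← prod_fin_succ_eq_prod_Icc k fun j => Real.sin ((j : ℝ) * (Real.pi / (2 * k + 1 : ℕ))),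
    ← prod_fin_succ_eq_prod_Icc k
      fun j => Real.sin ((j * (a + 1) : ℕ) * (Real.pi / (2 * k + 1 : ℕ))), hdet']
  refine Finset.prod_congr rfl fun j _ => ?_
  congr 1
  simp only [hθ]
  push_cast
  ring

theorem det_evenWalkMatrix_eq (k : ℕ) (hk : 0 < k) (n : ℕ) (a : Fin (2 * k - 1 + 1)) :
    (evenWalkMatrix k hk n a).det =
      if Nat.gcd (a + 1) (2 * k + 1) = 1 then
        (-1) ^ (∑ i ∈ Icc 1 k, i * (a + 1) / (2 * k + 1)) else 0 := by
  have h := det_evenWalkMatrix k hk n a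
  apply mul_right_cancel₀ (prod_sin_pos k).ne'
  rw [h]
  split_ifs with hg
  · exact prod_sin_mul_of_coprime k _ hg
  · rw [prod_sin_mul_of_not_coprime k _ hg, zero_mul]

theorem hankel_eq_mul_transpose (k : ℕ) (hk : 0 < k) (n : ℕ) (a b : Fin (2 * k - 1 + 1)) :
    (Matrix.of fun i j : Fin k =>
      (numBoundedUpDownPaths (2 * k - 1) (2 * n + 2 * (i : ℕ) + 2 * (j : ℕ) + a + b) a b : ℝ)) =
      evenWalkMatrix k hk 0 a * (evenWalkMatrix k hk n b)ᵀ := by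
  ext i j
  rw [Matrix.of_apply, numBoundedUpDownPaths_eq_pow, pathAdj_pow_map,
    -- All of `2 * n` goes to the second factor; the split is arbitrary, since neither determinant
    -- depends on it.
    show 2 * n + 2 * (i : ℕ) + 2 * (j : ℕ) + a + b =
      (2 * 0 + 2 * (i : ℕ) + a) + (2 * n + 2 * (j : ℕ) + b) by ring,
    pow_add, Matrix.mul_apply, sum_even_heights k hk, Matrix.mul_apply]
  · refine Finset.sum_congr rfl fun l _ => ?_
    simp only [evenWalkMatrix, Matrix.of_apply, Matrix.transpose_apply]
    rw [pathAdj_pow_symm _ _ _ b]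
  · intro x hx
    rw [pathAdj_pow_eq_zero _ _ _ _ (by omega), zero_mul]

theorem theorem56 (n k r s : ℕ) (hr : r + 1 ≤ 2 * k) (hs : s + 1 ≤ 2 * k) :
    Matrix.det (Matrix.of fun i j : Fin k =>
        (numBoundedUpDownPaths (2 * k - 1)
          (2 * n + 2 * (i : ℕ) + 2 * (j : ℕ) + r + s) r s : ℤ)) =
      if Nat.gcd (r + 1) (2 * k + 1) = 1 ∧ Nat.gcd (s + 1) (2 * k + 1) = 1 then
        (-1 : ℤ) ^ (∑ i ∈ Finset.Icc 1 k,
          (⌊((i * (r + 1) : ℕ) : ℚ) / ((2 * k + 1 : ℕ) : ℚ)⌋₊ +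
            ⌊((i * (s + 1) : ℕ) : ℚ) / ((2 * k + 1 : ℕ) : ℚ)⌋₊))
      else 0 := by
  have hk : 0 < k := by omega
  have key := congrArg Matrix.det (hankel_eq_mul_transpose k hk n
    ⟨r, by omega⟩ ⟨s, by omega⟩)
  rw [Matrix.det_mul, Matrix.det_transpose, det_evenWalkMatrix_eq, det_evenWalkMatrix_eq] at key
  simp only [Nat.floor_div_eq_div, Finset.sum_add_distrib]
  apply Int.cast_injective (α := ℝ)
  rw [Int.cast_det]
  refine Eq.trans (congrArg Matrix.det ?_) (key.trans ?_)
  · ext i j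
    simp
  · by_cases h1 : Nat.gcd (r + 1) (2 * k + 1) = 1 <;>
      by_cases h2 : Nat.gcd (s + 1) (2 * k + 1) = 1 <;> simp [h1, h2, pow_add]
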